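/- Let $v,k,s,t$ be integers with $0\le t\le s\le k\le v/2$. For integers $0\le a\le b\le v$ let $W_{ab}$ be the $(0,1)$-matrix with rows indexed by the $a$-subsets $S$ and columns by the $b$-subsets $K$ of a fixed $v$-set, with $W_{ab}(S,K)=1$ if and only if $S\subseteq K$. Let $F_{sk}^t(z)$ be the matrix, indexed in the same way by $s$-subsets $S$ and $k$-subsets $K$, with entries $$F_{sk}^t(z)(S,K)=\sum_{i=0}^{t}\binom{|S\cap K|}{i}z^i .$$ For $0\le j\le t$ put $$\mu_j(z)=\sum_{i=j}^{t}\binom{k-j}{i-j}\binom{v-j-i}{k-i}z^i,\qquad \alpha_j(z)=L_{ks}\,\mu_j(z),$$ where, with $D=d/dz$, $$L_{ks}=\frac{1}{(k-s)!}(k-zD)(k-1-zD)\cdots(s+1-zD).$$ Then for $0\le j\le t$ $$\alpha_j(z)=(-1)^{k+s}\sum_{i=j}^{t}\binom{k-j}{i-j}\binom{v-j-i}{k-i}\binom{i-s-1}{k-s}z^i ,$$ where $\binom{x}{n}=x(x-1)\cdots(x-n+1)/n!$ for every integer $x$ and every integer $n\ge 0$. Moreover, the eigenvalues of the matrix $W_{sk}^{\top}F_{sk}^t(z)$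 over the field $\mathbb{R}(z)$ of rational functions are $\alpha_j(z)$ with multiplicity $\binom{v}{j}-\binom{v}{j-1}$ for $j=0,1,\dots,t$ (where $\binom{v}{-1}=0$), and $0$ with multiplicity $\binom{v}{k}-\binom{v}{t}$. This holds for the algebraic multiplicities, that is, $$\det\bigl(xI-W_{sk}^{\top}F_{sk}^t(z)\bigr)=x^{\binom{v}{k}-\binom{v}{t}}\prod_{j=0}^{t}\bigl(x-\alpha_j(z)\bigr)^{\binom{v}{j}-\binom{v}{j-1}},$$ and also for the geometric ones: the eigenspaces for $\alpha_j(z)$, $0\le j\le t$, and the kernel have these dimensions over $\mathbb{R}(z)$. -/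

import Mathlib

open Polynomial

namespace IntersectionMatrix

noncomputable section

/-- The type of `k`-subsets of the `v`-set `Fin v`. -/
abbrev KSub (v k : ℕ) : Type := {S : Finset (Fin v) // S.card = k}

/-- The inclusion matrix `W_{sk}(v)`, with entries in a commutative ring `R`. -/
def W (R : Type*) [CommRing R] (v s k : ℕ) : Matrix (KSub v s) (KSub v k) R :=
  Matrix.of fun S K => if S.1 ⊆ K.1 then 1 else 0

/-- The intersection matrix `A_{sk}^i(v)`, whose `(S, K)` entry is `|S ∩ K|` choose `i`. -/
def A (R : Type*) [CommRing R] (v s k i : ℕ) : Matrix (KSub v s) (KSub v k) R :=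
  Matrix.of fun S K => (((S.1 ∩ K.1).card.choose i : ℕ) : R)

/-- The matrix polynomial `F_{sk}^t(v)(z) = ∑_{i=0}^t A_{sk}^i(v) z^i`. -/
def F (v s k t : ℕ) : Matrix (KSub v s) (KSub v k) ℝ[X] :=
  ∑ i ∈ Finset.range (t + 1), (X ^ i : ℝ[X]) • A ℝ[X] v s k i

/-- The differential operator `z D`, where `D = d/dz`, acting on real polynomials in `z`. -/
def zD : Module.End ℝ ℝ[X] := LinearMap.mulLeft ℝ (X : ℝ[X]) * Polynomial.derivative

/-- The operator `L_{ks} = (1 / (k-s)!) (k - zD)(k - 1 - zD) ⋯ (s + 1 - zD)`, for `s ≤ k`. -/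
def L (k s : ℕ) : Module.End ℝ ℝ[X] :=
  (1 / ((k - s).factorial : ℝ)) •
    ((List.range (k - s)).map fun m : ℕ => ((k : ℝ) - (m : ℝ)) • (1 : Module.End ℝ ℝ[X]) - zD).prod

/-- `μ_j(z) = ∑_{i=j}^t C(k-j, i-j) C(v-j-i, k-i) z^i`. -/
def mu (v k t j : ℕ) : ℝ[X] :=
  ∑ i ∈ Finset.Icc j t, C (((k - j).choose (i - j) * (v - j - i).choose (k - i) : ℕ) : ℝ) * X ^ i

/-- `α_j(z) = L_{ks} μ_j(z)`. -/
def alpha (v k s t j : ℕ) : ℝ[X] := L k s (mu v k t j)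

/-- `C(v, j) - C(v, j-1)`, with the convention `C(v, -1) = 0`. -/
def mult (v : ℕ) : ℕ → ℕ
  | 0 => v.choose 0
  | j + 1 => v.choose (j + 1) - v.choose j

/-- The matrix `W_{sk}ᵀ F_{sk}^t(z)`, with entries in the field `ℝ(z)` of rational functions. -/
def WF (v s k t : ℕ) : Matrix (KSub v k) (KSub v k) (RatFunc ℝ) :=
  (W (RatFunc ℝ) v s k).transpose * (F v s k t).map (algebraMap ℝ[X] (RatFunc ℝ))

end

end IntersectionMatrix

namespace IntersectionMatrix

/-! ### Counting subsets above and between given sets. -/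

section Combinatorics

/-! Since `A^i_{sk} = W_{is}ᵀ W_{ik}` and `W_{is} W_{sk} = C(k-i, s-i) W_{ik}`, the matrix is a
combination of the `W_{ik}ᵀ W_{ik}`, `i ≤ t`, with coefficients `C(k-i, k-s) z^i` (`WF_eq_sum`).
Call `f` on `j`-subsets harmonic if `W_{mj} f = 0` for all `m < j`. Then `W_{jk}ᵀ f` is a common
eigenvector of all these products (`transpose_W_mulVec_W_mulVec`), and the resulting eigenvalue is
`α_j`, because `L_{ks}` multiplies `z^i` by `C(k-i, k-s)`.

Rank-nullity bounds the dimension of the harmonic space, and of the kernel, from below. These bounds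
add up to `C(v, k)`, and the eigenvalues `0, α_0, ..., α_t` are distinct, so every bound is an
equality, both geometrically and algebraically (`finrank_eigenspace_eq_and_charpoly_eq`). -/

theorem sum_KSub_ite (R : Type*) [CommRing R] {v k : ℕ} (P : Finset (Fin v) → Prop)
    [DecidablePred P] :
    ∑ K : KSub v k, (if P K.1 then (1 : R) else 0) =
      (((Finset.powersetCard k (Finset.univ : Finset (Fin v))).filter P).card : R) := by
  rw [← Finset.sum_boole]
  exact (Finset.sum_subtype _ (fun x => by simp [Finset.mem_powersetCard])
    (fun K => if P K then (1 : R) else 0)).symm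

theorem card_KSub (v k : ℕ) : Fintype.card (KSub v k) = v.choose k := by
  simp

/-- Complementation turns supersets of `U` into subsets of `Uᶜ`. Choosing `v - k` rather than `k -
|U|` elements keeps the count correct (zero) when `|U| > k`. -/
theorem card_powersetCard_filter_superset {v k : ℕ} (hk : k ≤ v) (U : Finset (Fin v)) :
    ((Finset.powersetCard k (Finset.univ : Finset (Fin v))).filter (U ⊆ ·)).card =
      (v - U.card).choose (v - k) := by
  have h : (v - U.card).choose (v - k) = (Finset.powersetCard (v - k) Uᶜ).card := by
    simp [Finset.card_compl]
  rw [h]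
  refine Finset.card_bij' (fun K _ => Kᶜ) (fun K _ => Kᶜ) ?_ ?_ (by simp) (by simp)
  · intro K hK
    simp only [Finset.mem_filter, Finset.mem_powersetCard] at hK ⊢
    exact ⟨Finset.compl_subset_compl.2 hK.2, by simp [Finset.card_compl, hK.1.2]⟩
  · intro K hK
    simp only [Finset.mem_filter, Finset.mem_powersetCard] at hK ⊢
    refine ⟨⟨Finset.subset_univ _, ?_⟩, ?_⟩
    · rw [Finset.card_compl, hK.2, Fintype.card_fin]; omega
    · simpa using Finset.compl_subset_compl.2 hK.1

theorem card_powersetCard_filter_between {v i j : ℕ} (hij : i ≤ j) {I K : Finset (Fin v)}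
    (hI : I.card = i) (hIK : I ⊆ K) :
    ((Finset.powersetCard j (Finset.univ : Finset (Fin v))).filter
      (fun J => I ⊆ J ∧ J ⊆ K)).card = (K.card - i).choose (j - i) := by
  have h : (K.card - i).choose (j - i) = (Finset.powersetCard (j - i) (K \ I)).card := by
    rw [Finset.card_powersetCard, Finset.card_sdiff_of_subset hIK, hI]
  rw [h]
  refine Finset.card_bij' (fun J _ => J \ I) (fun J _ => J ∪ I) ?_ ?_ ?_ ?_
  · intro J hJ
    simp only [Finset.mem_filter, Finset.mem_powersetCard] at hJ ⊢
    refine ⟨Finset.sdiff_subset_sdiff hJ.2.2 subset_rfl, ?_⟩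
    rw [Finset.card_sdiff_of_subset hJ.2.1, hI, hJ.1.2]
  · intro J hJ
    simp only [Finset.mem_filter, Finset.mem_powersetCard] at hJ ⊢
    refine ⟨⟨Finset.subset_univ _, ?_⟩, Finset.subset_union_right,
      Finset.union_subset (hJ.1.trans Finset.sdiff_subset) hIK⟩
    rw [Finset.card_union_of_disjoint
      (Finset.disjoint_of_subset_left hJ.1 Finset.sdiff_disjoint), hJ.2, hI]
    omega
  · intro J hJ
    simp only [Finset.mem_filter] at hJ
    exact Finset.sdiff_union_of_subset hJ.2.1
  · intro J hJ
    simp only [Finset.mem_powersetCard] at hJ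
    exact Finset.union_sdiff_cancel_right
      (Finset.disjoint_of_subset_left hJ.1 Finset.sdiff_disjoint)

end Combinatorics

/-! ### Product identities for inclusion matrices. -/

section InclusionMatrices

variable (R : Type*) [CommRing R]

theorem W_self (v j : ℕ) : W R v j j = 1 := by
  ext I J
  simp only [W, Matrix.of_apply, Matrix.one_apply]
  refine if_congr ⟨fun h => Subtype.ext (Finset.eq_of_subset_of_card_le h ?_), ?_⟩ rfl rfl
  · rw [I.2, J.2]
  · rintro rfl; exact subset_rfl

theorem W_eq_zero_of_lt {v j i : ℕ} (h : i < j) : W R v j i = 0 := by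
  ext J I
  simp only [W, Matrix.of_apply, Matrix.zero_apply]
  refine if_neg fun hs => ?_
  have := Finset.card_le_card hs
  rw [J.2, I.2] at this
  omega

theorem W_mul_W {v i j k : ℕ} (hij : i ≤ j) :
    W R v i j * W R v j k = (((k - i).choose (j - i) : ℕ) : R) • W R v i k := by
  ext I K
  simp only [Matrix.mul_apply, W, Matrix.of_apply, Matrix.smul_apply, ← ite_and, mul_ite, mul_one,
    mul_zero, smul_eq_mul]
  have h := sum_KSub_ite R (v := v) (k := j) (fun J => J ⊆ K.1 ∧ I.1 ⊆ J)
  rw [h]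
  split_ifs with hIK
  · have := card_powersetCard_filter_between hij I.2 hIK
    rw [K.2] at this
    simp only [and_comm (a := _ ⊆ K.1), this]
  · rw [Finset.filter_false_of_mem fun J _ hJ => hIK (hJ.2.trans hJ.1)]
    simp

theorem transpose_W_mul_W (v s k i : ℕ) : (W R v i s).transpose * W R v i k = A R v s k i := by
  ext S K
  simp only [Matrix.mul_apply, Matrix.transpose_apply, W, A, Matrix.of_apply, ← ite_and, mul_ite,
    mul_one, mul_zero]
  have h := sum_KSub_ite R (v := v) (k := i) (fun I => I ⊆ K.1 ∧ I ⊆ S.1)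
  rw [h, ← Finset.card_powersetCard]
  congr 2
  ext I
  simp only [Finset.mem_filter, Finset.mem_powersetCard, Finset.subset_inter_iff]
  have := Finset.subset_univ I
  tauto

/-- An entry counts the `k`-sets containing `I ∪ J`. As `v - |I ∪ J| = |I ∩ J| + (v - i - j)`,
Vandermonde expands this count in the `C(|I ∩ J|, m)`, which vanish for `m > j`. -/
theorem W_mul_transpose_W {v i j k : ℕ} (hk : k ≤ v) (hij : i + j ≤ v) (hjk : j ≤ v - k) :
    W R v i k * (W R v j k).transpose =
      ∑ m ∈ Finset.range (j + 1),
        (((v - i - j).choose (v - k - m) : ℕ) : R) • ((W R v m i).transpose * W R v m j) := by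
  simp only [transpose_W_mul_W]
  ext I J
  simp only [Matrix.sum_apply, Matrix.smul_apply, Matrix.mul_apply, Matrix.transpose_apply, W, A,
    Matrix.of_apply, ← ite_and, mul_ite, mul_one, mul_zero, smul_eq_mul]
  have h := sum_KSub_ite R (v := v) (k := k) (fun K => J.1 ⊆ K ∧ I.1 ⊆ K)
  rw [h]
  simp only [← Finset.union_subset_iff]
  rw [card_powersetCard_filter_superset hk]
  have hc := Finset.card_union_add_card_inter I.1 J.1
  rw [I.2, J.2] at hc
  have hx : (I.1 ∩ J.1).card ≤ j :=
    (Finset.card_le_card Finset.inter_subset_right).trans_eq J.2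
  have hv : v - (J.1 ∪ I.1).card = (I.1 ∩ J.1).card + (v - i - j) := by
    rw [Finset.union_comm]
    have := card_finset_fin_le (I.1 ∪ J.1)
    omega
  rw [hv, Nat.add_choose_eq, Finset.Nat.sum_antidiagonal_eq_sum_range_succ_mk]
  norm_cast
  refine congrArg Nat.cast <| .symm <| (Finset.sum_subset (Finset.range_mono (Nat.succ_le_succ hjk)) ?_).trans
    (Finset.sum_congr rfl fun _ _ => mul_comm _ _)
  intro m _ hm
  rw [Nat.choose_eq_zero_of_lt (n := (I.1 ∩ J.1).card), mul_zero]
  simp only [Finset.mem_range] at hm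
  omega

end InclusionMatrices

/-! ### Harmonic vectors and their lifts to `k`-subsets. -/

section Harmonic

variable {K : Type*} [Field K]

theorem W_mulVec_eq_zero_of_le [CharZero K] {v m l j : ℕ} (hml : m ≤ l) (hlj : l ≤ j) {f : KSub v j → K}
    (hf : (W K v l j).mulVec f = 0) : (W K v m j).mulVec f = 0 := by
  have h := congrArg (Matrix.mulVec · f) (W_mul_W K (v := v) (k := j) hml)
  simp only [← Matrix.mulVec_mulVec, hf, Matrix.mulVec_zero, Matrix.smul_mulVec] at h
  refine (smul_eq_zero.1 h.symm).resolve_left ?_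
  exact_mod_cast (Nat.choose_pos (by omega)).ne'

/-- Harmonicity kills every term of `W_mul_transpose_W` except `m = j`. -/
theorem W_mulVec_transpose_W_mulVec {v i j k : ℕ} (hik : i ≤ k) (hjk : j ≤ k) (hkv : 2 * k ≤ v)
    {f : KSub v j → K} (hf : ∀ m < j, (W K v m j).mulVec f = 0) :
    (W K v i k).mulVec ((W K v j k).transpose.mulVec f) =
      (((v - j - i).choose (k - i) : ℕ) : K) • (W K v j i).transpose.mulVec f := by
  rw [Matrix.mulVec_mulVec, W_mul_transpose_W K (by omega) (by omega) (by omega),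
    Matrix.sum_mulVec, Finset.sum_range_succ, Finset.sum_eq_zero, zero_add, W_self, Matrix.mul_one,
    Matrix.smul_mulVec]
  · congr 2
    rw [Nat.sub_right_comm]
    exact Nat.choose_symm_of_eq_add (by omega)
  · intro m hm
    rw [Matrix.smul_mulVec, ← Matrix.mulVec_mulVec, hf m (Finset.mem_range.1 hm),
      Matrix.mulVec_zero, smul_zero]

/-- Lifting is injective on harmonic vectors: `W_{jk}` undoes it up to the scalar `C(v-2j, k-j)`,
nonzero because `2k ≤ v`. -/
theorem transpose_W_mulVec_eq_zero [CharZero K] {v j k : ℕ} (hjk : j ≤ k) (hkv : 2 * k ≤ v)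
    {f : KSub v j → K} (hf : ∀ m < j, (W K v m j).mulVec f = 0)
    (h : (W K v j k).transpose.mulVec f = 0) : f = 0 := by
  have h1 := W_mulVec_transpose_W_mulVec hjk hjk hkv hf
  rw [h, Matrix.mulVec_zero, W_self, Matrix.transpose_one, Matrix.one_mulVec] at h1
  refine (smul_eq_zero.1 h1.symm).resolve_left ?_
  exact_mod_cast (Nat.choose_pos (by omega)).ne'

theorem transpose_W_mulVec_W_mulVec {v i j k : ℕ} (hik : i ≤ k) (hjk : j ≤ k) (hkv : 2 * k ≤ v)
    {f : KSub v j → K} (hf : ∀ m < j, (W K v m j).mulVec f = 0) :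
    ((W K v i k).transpose * W K v i k).mulVec ((W K v j k).transpose.mulVec f) =
      (if j ≤ i then (((k - j).choose (i - j) * (v - j - i).choose (k - i) : ℕ) : K) else 0) •
        (W K v j k).transpose.mulVec f := by
  rw [← Matrix.mulVec_mulVec, W_mulVec_transpose_W_mulVec hik hjk hkv hf, Matrix.mulVec_smul,
    Matrix.mulVec_mulVec, ← Matrix.transpose_mul]
  split_ifs with hji
  · rw [W_mul_W K hji, Matrix.transpose_smul, Matrix.smul_mulVec, smul_smul, Nat.cast_mul, mul_comm]
  · rw [W_eq_zero_of_lt K (not_le.1 hji)]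
    simp

theorem sub_le_finrank_ker_toLin' {m n : Type*} [Fintype m] [Fintype n] [DecidableEq n]
    (M : Matrix m n K) :
    Fintype.card n - Fintype.card m ≤ Module.finrank K (LinearMap.ker M.toLin') := by
  have h := M.toLin'.finrank_range_add_finrank_ker
  have h2 := Submodule.finrank_le (LinearMap.range M.toLin')
  simp only [Module.finrank_fintype_fun_eq_card] at h h2
  omega

end Harmonic

/-! ### From lower bounds on eigenspaces to exact multiplicities. -/

section Diagonalizable

/-- Each `d i` is at most the geometric, hence the algebraic, multiplicity, while the algebraic ones
sum to at most the degree `∑ d i`; equality is forced throughout. -/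
theorem finrank_eigenspace_eq_and_charpoly_eq {K n ι : Type*} [Field K] [Fintype n] [DecidableEq n]
    [Fintype ι] (M : Matrix n n K) (ev : ι → K) (hev : Function.Injective ev) (d : ι → ℕ)
    (hd : ∀ i, d i ≤ Module.finrank K (Module.End.eigenspace M.toLin' (ev i)))
    (hsum : ∑ i, d i = Fintype.card n) :
    (∀ i, Module.finrank K (Module.End.eigenspace M.toLin' (ev i)) = d i) ∧
      M.charpoly = ∏ i, (X - C (ev i)) ^ d i := by
  have hle : ∀ i, Module.finrank K (Module.End.eigenspace M.toLin' (ev i)) ≤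
      M.charpoly.rootMultiplicity (ev i) := fun i => by
    simpa using LinearMap.finrank_eigenspace_le M.toLin' (ev i)
  have hmonic : (∏ i, (X - C (ev i)) ^ M.charpoly.rootMultiplicity (ev i)).Monic :=
    monic_prod_of_monic _ _ fun i _ => (monic_X_sub_C _).pow _
  have hdvd : ∏ i, (X - C (ev i)) ^ M.charpoly.rootMultiplicity (ev i) ∣ M.charpoly :=
    Finset.prod_dvd_of_coprime
      (fun i _ j _ hij => (pairwise_coprime_X_sub_C hev hij).pow)
      (fun i _ => pow_rootMultiplicity_dvd _ _)
  have hdeg : (∏ i, (X - C (ev i)) ^ M.charpoly.rootMultiplicity (ev i)).natDegree =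
      ∑ i, M.charpoly.rootMultiplicity (ev i) := by
    rw [natDegree_prod_of_monic _ _ fun i _ => (monic_X_sub_C _).pow _]
    simp
  have hub : ∑ i, M.charpoly.rootMultiplicity (ev i) ≤ ∑ i, d i := by
    rw [hsum, ← hdeg, ← Matrix.charpoly_natDegree_eq_dim M]
    exact natDegree_le_of_dvd hdvd (Matrix.charpoly_monic M).ne_zero
  have heq : ∀ i, d i = M.charpoly.rootMultiplicity (ev i) := fun i =>
    (Finset.sum_eq_sum_iff_of_le fun i _ => (hd i).trans (hle i)).1
      (le_antisymm (Finset.sum_le_sum fun i _ => (hd i).trans (hle i)) hub) i (Finset.mem_univ i)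
  refine ⟨fun i => le_antisymm ((hle i).trans_eq (heq i).symm) (hd i), ?_⟩
  simp only [heq]
  refine (eq_of_monic_of_dvd_of_natDegree_le hmonic (Matrix.charpoly_monic M) hdvd ?_)
  rw [hdeg, Matrix.charpoly_natDegree_eq_dim, ← hsum, Finset.sum_congr rfl fun i _ => heq i]

end Diagonalizable

/-! ### The polynomials `α_j`. -/

section Alpha

theorem zD_X_pow (i : ℕ) : zD (X ^ i : ℝ[X]) = (i : ℝ) • X ^ i := by
  cases i with
  | zero => simp [zD]
  | succ i =>
    simp only [zD, Module.End.mul_apply, LinearMap.mulLeft_apply, derivative_X_pow, smul_eq_C_mul,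
      Nat.add_sub_cancel]
    ring

theorem L_prod_X_pow {k i : ℕ} (hik : i ≤ k) (n : ℕ) :
    ((List.range n).map fun m : ℕ =>
      ((k : ℝ) - (m : ℝ)) • (1 : Module.End ℝ ℝ[X]) - zD).prod (X ^ i) =
      ((k - i).descFactorial n : ℝ) • X ^ i := by
  induction n with
  | zero => simp
  | succ n ih =>
    rw [List.range_succ, List.map_append, List.prod_append, Module.End.mul_apply]
    simp only [List.map_cons, List.map_nil, List.prod_cons, List.prod_nil, mul_one,
      LinearMap.sub_apply, LinearMap.smul_apply, Module.End.one_apply, zD_X_pow, ← sub_smul,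
      map_smul, ih, smul_smul]
    congr 1
    rw [Nat.descFactorial_succ, Nat.cast_mul]
    -- Past `n = k - i` the truncated factor `k - i - n` differs from the real one, but the falling
    -- factorial is already zero.
    rcases le_or_gt n (k - i) with h | h
    · rw [Nat.cast_sub h, Nat.cast_sub hik]
      ring
    · simp [Nat.descFactorial_eq_zero_iff_lt.2 h]

theorem L_X_pow {k i : ℕ} (s : ℕ) (hik : i ≤ k) :
    L k s (X ^ i) = ((k - i).choose (k - s) : ℝ) • X ^ i := by
  rw [L, LinearMap.smul_apply, L_prod_X_pow hik, smul_smul, Nat.descFactorial_eq_factorial_mul_choose]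
  congr 1
  have : ((k - s).factorial : ℝ) ≠ 0 := by exact_mod_cast Nat.factorial_ne_zero _
  push_cast
  field_simp

theorem alpha_eq_sum_choose {v k s t j : ℕ} (htk : t ≤ k) :
    alpha v k s t j = ∑ i ∈ Finset.Icc j t,
      C ((((k - j).choose (i - j) * (v - j - i).choose (k - i) : ℕ) : ℝ) *
        ((k - i).choose (k - s) : ℝ)) * X ^ i := by
  rw [alpha, mu, map_sum]
  refine Finset.sum_congr rfl fun i hi => ?_
  rw [← smul_eq_C_mul, map_smul, L_X_pow s ((Finset.mem_Icc.1 hi).2.trans htk), smul_smul,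
    smul_eq_C_mul]

theorem ringChoose_sub_sub_one {k s i : ℕ} (his : i ≤ s) (hsk : s ≤ k) :
    Ring.choose ((i : ℤ) - s - 1) (k - s) = (-1) ^ (k + s) * ((k - i).choose (k - s) : ℤ) := by
  have h : ((i : ℤ) - s - 1) = -((s - i + 1 : ℕ) : ℤ) := by push_cast [his]; ring
  have h2 : ((s - i + 1 : ℕ) : ℤ) + (k - s : ℕ) - 1 = ((k - i : ℕ) : ℤ) := by omega
  have h3 : (-1 : ℤ) ^ (k + s) = (-1) ^ (k - s) := by
    rw [show k + s = (k - s) + 2 * s by omega, pow_add, pow_mul]; simp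
  rw [h, Ring.choose_neg, h2, Ring.choose_natCast, h3, Units.smul_def, smul_eq_mul,
    Int.coe_negOnePow_natCast]

theorem alpha_eq_ringChoose {v k s t j : ℕ} (hts : t ≤ s) (hsk : s ≤ k) :
    alpha v k s t j = (-1) ^ (k + s) * ∑ i ∈ Finset.Icc j t,
      C ((((k - j).choose (i - j) : ℕ) : ℝ) * (((v - j - i).choose (k - i) : ℕ) : ℝ) *
        ((Ring.choose ((i : ℤ) - (s : ℤ) - 1) (k - s) : ℤ) : ℝ)) * X ^ i := by
  rw [alpha_eq_sum_choose (hts.trans hsk), Finset.mul_sum]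
  refine Finset.sum_congr rfl fun i hi => ?_
  rw [ringChoose_sub_sub_one ((Finset.mem_Icc.1 hi).2.trans hts) hsk,
    show ((-1 : ℝ[X]) ^ (k + s)) = C ((-1) ^ (k + s)) by simp, ← mul_assoc, ← C_mul]
  congr 2
  push_cast
  have h : ((-1 : ℝ) ^ (k + s)) * (-1) ^ (k + s) = 1 := by rw [← mul_pow]; simp
  linear_combination (-(((k - j).choose (i - j) : ℝ) * ((v - j - i).choose (k - i) : ℝ) *
    ((k - i).choose (k - s) : ℝ))) * h

theorem coeff_alpha {v k s t j : ℕ} (htk : t ≤ k) (n : ℕ) :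
    (alpha v k s t j).coeff n = if n ∈ Finset.Icc j t then
      (((k - j).choose (n - j) * (v - j - n).choose (k - n) : ℕ) : ℝ) *
        ((k - n).choose (k - s) : ℝ) else 0 := by
  simp only [alpha_eq_sum_choose htk, finsetSum_coeff, coeff_C_mul_X_pow, Finset.sum_ite_eq]

theorem coeff_alpha_self_ne_zero {v k s t j : ℕ} (hjt : j ≤ t) (hts : t ≤ s) (hsk : s ≤ k)
    (hkv : 2 * k ≤ v) : (alpha v k s t j).coeff j ≠ 0 := by
  rw [coeff_alpha (hts.trans hsk), if_pos (by simpa using hjt)]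
  have h1 := (Nat.choose_pos (show j - j ≤ k - j by omega)).ne'
  have h2 := (Nat.choose_pos (show k - j ≤ v - j - j by omega)).ne'
  have h3 := (Nat.choose_pos (show k - s ≤ k - j by omega)).ne'
  exact mul_ne_zero (Nat.cast_ne_zero.2 (mul_ne_zero h1 h2)) (Nat.cast_ne_zero.2 h3)

/-- The lowest term of `α_i` is in degree `i`, where `α_j` has no term. -/
theorem alpha_ne_alpha_of_lt {v k s t i j : ℕ} (hij : i < j) (hit : i ≤ t) (hts : t ≤ s)
    (hsk : s ≤ k) (hkv : 2 * k ≤ v) : alpha v k s t i ≠ alpha v k s t j := fun h => by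
  refine coeff_alpha_self_ne_zero hit hts hsk hkv ?_
  rw [h, coeff_alpha (hts.trans hsk), if_neg (by simp [hij])]

end Alpha

/-! ### Eigenvectors of `WF` and dimension counts. -/

section Eigenvectors

theorem WF_eq_sum {v k s t : ℕ} (hts : t ≤ s) (hsk : s ≤ k) :
    WF v s k t = ∑ i ∈ Finset.range (t + 1),
      (algebraMap ℝ[X] (RatFunc ℝ) (C ((k - i).choose (k - s) : ℝ) * X ^ i)) •
        ((W (RatFunc ℝ) v i k).transpose * W (RatFunc ℝ) v i k) := by
  have hF : (F v s k t).map (algebraMap ℝ[X] (RatFunc ℝ)) = ∑ i ∈ Finset.range (t + 1),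
      (algebraMap ℝ[X] (RatFunc ℝ) (X ^ i)) • A (RatFunc ℝ) v s k i := by
    ext S K
    simp [F, A, Matrix.sum_apply]
  rw [WF, hF, Matrix.mul_sum]
  refine Finset.sum_congr rfl fun i hi => ?_
  have hi : i ≤ t := Nat.lt_succ_iff.1 (Finset.mem_range.1 hi)
  rw [← transpose_W_mul_W, Matrix.mul_smul, ← Matrix.mul_assoc, ← Matrix.transpose_mul,
    W_mul_W _ (hi.trans hts), Matrix.transpose_smul, Matrix.smul_mul, smul_smul,
    Nat.choose_symm_of_eq_add (show k - i = (s - i) + (k - s) by omega), mul_comm, map_mul]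
  simp

theorem WF_mulVec_transpose_W_mulVec {v k s t j : ℕ} (hjt : j ≤ t) (hts : t ≤ s) (hsk : s ≤ k)
    (hkv : 2 * k ≤ v) {f : KSub v j → RatFunc ℝ}
    (hf : ∀ m < j, (W (RatFunc ℝ) v m j).mulVec f = 0) :
    (WF v s k t).mulVec ((W (RatFunc ℝ) v j k).transpose.mulVec f) =
      algebraMap ℝ[X] (RatFunc ℝ) (alpha v k s t j) •
        (W (RatFunc ℝ) v j k).transpose.mulVec f := by
  rw [WF_eq_sum hts hsk, Matrix.sum_mulVec, alpha_eq_sum_choose (hts.trans hsk), map_sum,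
    Finset.sum_smul]
  have hsub : Finset.Icc j t ⊆ Finset.range (t + 1) := fun i hi => by
    simp only [Finset.mem_Icc, Finset.mem_range] at hi ⊢; omega
  refine .trans (Finset.sum_subset hsub ?_).symm (Finset.sum_congr rfl ?_)
  · intro i hi hi'
    simp only [Finset.mem_Icc, Finset.mem_range] at hi hi'
    rw [Matrix.smul_mulVec, transpose_W_mulVec_W_mulVec (by omega) (by omega) hkv hf,
      if_neg (by omega), zero_smul, smul_zero]
  · intro i hi
    simp only [Finset.mem_Icc] at hi
    rw [Matrix.smul_mulVec, transpose_W_mulVec_W_mulVec (by omega) (by omega) hkv hf,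
      if_pos hi.1, smul_smul]
    congr 1
    simp only [map_mul, map_natCast]
    ring

theorem mult_le_finrank_eigenspace {v k s t j : ℕ} (hjt : j ≤ t) (hts : t ≤ s) (hsk : s ≤ k)
    (hkv : 2 * k ≤ v) :
    mult v j ≤ Module.finrank (RatFunc ℝ) (Module.End.eigenspace (Matrix.toLin' (WF v s k t))
      (algebraMap ℝ[X] (RatFunc ℝ) (alpha v k s t j))) := by
  -- `U` consists of harmonic vectors: everything if `j = 0`, otherwise the kernel of `W_{j-1,j}`,
  -- which lies in that of every lower `W_{mj}`.
  obtain ⟨U, hU, hdim⟩ : ∃ U : Submodule (RatFunc ℝ) (KSub v j → RatFunc ℝ),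
      (∀ f ∈ U, ∀ m < j, (W (RatFunc ℝ) v m j).mulVec f = 0) ∧
        mult v j ≤ Module.finrank (RatFunc ℝ) U := by
    cases j with
    | zero => exact ⟨⊤, by simp, by simp [mult]⟩
    | succ j =>
      refine ⟨LinearMap.ker (W (RatFunc ℝ) v j (j + 1)).toLin', fun f hf m hm =>
        W_mulVec_eq_zero_of_le (Nat.lt_succ_iff.1 hm) j.le_succ (by simpa using hf), ?_⟩
      have := sub_le_finrank_ker_toLin' (W (RatFunc ℝ) v j (j + 1))
      rwa [card_KSub, card_KSub] at this
  refine hdim.trans ?_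
  have hmem : ∀ f : U, ((W (RatFunc ℝ) v j k).transpose.toLin' ∘ₗ U.subtype) f ∈
      Module.End.eigenspace (Matrix.toLin' (WF v s k t))
        (algebraMap ℝ[X] (RatFunc ℝ) (alpha v k s t j)) := fun f => by
    rw [Module.End.mem_eigenspace_iff]
    exact WF_mulVec_transpose_W_mulVec hjt hts hsk hkv (hU f f.2)
  refine LinearMap.finrank_le_finrank_of_injective (f := LinearMap.codRestrict _ _ hmem) ?_
  rw [← LinearMap.ker_eq_bot, LinearMap.ker_codRestrict, LinearMap.ker_eq_bot']
  exact fun f hf => Subtype.ext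
    (transpose_W_mulVec_eq_zero (hjt.trans (hts.trans hsk)) hkv (hU f f.2) hf)

/-- The kernel of `W_{tk}` is killed by every `W_{ik}` with `i ≤ t`, hence by `WF`. -/
theorem choose_sub_le_finrank_eigenspace_zero {v k s t : ℕ} (hts : t ≤ s) (hsk : s ≤ k) :
    v.choose k - v.choose t ≤
      Module.finrank (RatFunc ℝ) (Module.End.eigenspace (Matrix.toLin' (WF v s k t)) 0) := by
  have h := sub_le_finrank_ker_toLin' (W (RatFunc ℝ) v t k)
  rw [card_KSub, card_KSub] at h
  refine h.trans (Submodule.finrank_mono fun f hf => ?_)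
  rw [LinearMap.mem_ker, Matrix.toLin'_apply] at hf
  rw [Module.End.mem_eigenspace_iff, zero_smul, Matrix.toLin'_apply, WF_eq_sum hts hsk,
    Matrix.sum_mulVec]
  refine Finset.sum_eq_zero fun i hi => ?_
  rw [Matrix.smul_mulVec, ← Matrix.mulVec_mulVec,
    W_mulVec_eq_zero_of_le (Nat.lt_succ_iff.1 (Finset.mem_range.1 hi)) (hts.trans hsk) hf,
    Matrix.mulVec_zero, smul_zero]

theorem choose_le_choose_of_two_mul_le {v i j : ℕ} (hij : i ≤ j) (hj : 2 * j ≤ v) :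
    v.choose i ≤ v.choose j := by
  induction j, hij using Nat.le_induction with
  | base => exact le_rfl
  | succ j _ ih =>
    exact (ih (by omega)).trans (Nat.choose_le_succ_of_lt_half_left (by omega))

theorem sum_mult {v t : ℕ} (ht : 2 * t ≤ v) :
    ∑ j ∈ Finset.range (t + 1), mult v j = v.choose t := by
  induction t with
  | zero => simp [mult]
  | succ t ih =>
    rw [Finset.sum_range_succ, ih (by omega)]
    exact Nat.add_sub_cancel' (choose_le_choose_of_two_mul_le t.le_succ ht)

end Eigenvectors

end IntersectionMatrix

theorem mainTheorem4 (v k s t : ℕ) (hts : t ≤ s) (hsk : s ≤ k) (hkv : (k : ℝ) ≤ (v : ℝ) / 2) :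
    -- the explicit form of `α_j = L_{ks} μ_j`
    (∀ j ≤ t, IntersectionMatrix.alpha v k s t j =
      (-1) ^ (k + s) * ∑ i ∈ Finset.Icc j t,
        Polynomial.C ((((k - j).choose (i - j) : ℕ) : ℝ) * (((v - j - i).choose (k - i) : ℕ) : ℝ) *
          ((Ring.choose ((i : ℤ) - (s : ℤ) - 1) (k - s) : ℤ) : ℝ)) * Polynomial.X ^ i) ∧
    -- the list of eigenvalues with their algebraic multiplicities
    (IntersectionMatrix.WF v s k t).charpoly =
      (∏ j ∈ Finset.range (t + 1),
        (Polynomial.X - Polynomial.C (algebraMap (Polynomial ℝ) (RatFunc ℝ)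
          (IntersectionMatrix.alpha v k s t j))) ^ IntersectionMatrix.mult v j) *
        Polynomial.X ^ (v.choose k - v.choose t) ∧
    -- the geometric multiplicities are the same
    (∀ j ≤ t, Module.finrank (RatFunc ℝ)
      (Module.End.eigenspace (Matrix.toLin' (IntersectionMatrix.WF v s k t))
        (algebraMap (Polynomial ℝ) (RatFunc ℝ) (IntersectionMatrix.alpha v k s t j))) =
      IntersectionMatrix.mult v j) ∧
    Module.finrank (RatFunc ℝ)
      (Module.End.eigenspace (Matrix.toLin' (IntersectionMatrix.WF v s k t)) 0) =
      v.choose k - v.choose t := by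
  have hkv : 2 * k ≤ v := by
    have : (2 * k : ℝ) ≤ v := by linarith
    exact_mod_cast this
  -- `none` indexes the eigenvalue `0`, `some j` the eigenvalue `α_j`.
  let ev : Option (Fin (t + 1)) → RatFunc ℝ := fun o => o.elim 0 fun j =>
    algebraMap ℝ[X] (RatFunc ℝ) (IntersectionMatrix.alpha v k s t j)
  let d : Option (Fin (t + 1)) → ℕ := fun o =>
    o.elim (v.choose k - v.choose t) fun j => IntersectionMatrix.mult v j
  have hinj : Function.Injective (algebraMap ℝ[X] (RatFunc ℝ)) := RatFunc.algebraMap_injective ℝ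
  have hne : ∀ j ≤ t, IntersectionMatrix.alpha v k s t j ≠ 0 := fun j hj h =>
    IntersectionMatrix.coeff_alpha_self_ne_zero hj hts hsk hkv (by rw [h, Polynomial.coeff_zero])
  have hev : Function.Injective ev := by
    rintro (_ | i) (_ | j) h
    · rfl
    · exact absurd (hinj (h.symm.trans (map_zero _).symm)) (hne j (Nat.lt_succ_iff.1 j.2))
    · exact absurd (hinj (h.trans (map_zero _).symm)) (hne i (Nat.lt_succ_iff.1 i.2))
    · have h' := hinj h
      rcases lt_trichotomy (i : ℕ) j with hij | hij | hij
      · exact absurd h' (IntersectionMatrix.alpha_ne_alpha_of_lt hij (by omega) hts hsk hkv)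
      · rw [Fin.ext hij]
      · exact absurd h'.symm (IntersectionMatrix.alpha_ne_alpha_of_lt hij (by omega) hts hsk hkv)
  obtain ⟨hgeom, halg⟩ := IntersectionMatrix.finrank_eigenspace_eq_and_charpoly_eq
    (IntersectionMatrix.WF v s k t) ev hev d
    (by
      rintro (_ | j)
      · exact IntersectionMatrix.choose_sub_le_finrank_eigenspace_zero hts hsk
      · exact IntersectionMatrix.mult_le_finrank_eigenspace (Nat.lt_succ_iff.1 j.2) hts hsk hkv)
    (by
      rw [IntersectionMatrix.card_KSub, Fintype.sum_option]
      simp only [d, Option.elim]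
      rw [Fin.sum_univ_eq_sum_range (IntersectionMatrix.mult v),
        IntersectionMatrix.sum_mult (by omega)]
      exact Nat.sub_add_cancel
        (IntersectionMatrix.choose_le_choose_of_two_mul_le (hts.trans hsk) hkv))
  refine ⟨fun j _ => IntersectionMatrix.alpha_eq_ringChoose hts hsk, ?_,
    fun j hj => hgeom (some ⟨j, Nat.lt_succ_iff.2 hj⟩), hgeom none⟩
  rw [halg, Fintype.prod_option, mul_comm]
  simp only [ev, d, Option.elim, map_zero, sub_zero]
  rw [Fin.prod_univ_eq_prod_range (fun j => (Polynomial.X - Polynomial.C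
    (algebraMap ℝ[X] (RatFunc ℝ) (IntersectionMatrix.alpha v k s t j))) ^
      IntersectionMatrix.mult v j)]
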